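/- Let $k\ge 2$ be an integer. For $1\le i\le k$ let $$G_i=\prod_{n\ge 1,\ n\not\equiv 0,\ \pm(k+1-i)\ (\mathrm{mod}\ 2k+1)}\frac{1}{1-q^n},$$ and for $j\ge 1$ and $2\le i\le k$ define recursively $$G_{(k-1)j+i}=\frac{G_{(k-1)(j-1)+k-i+1}-G_{(k-1)(j-1)+k-i+2}}{q^{(i-1)j}}$$ (a formal series in $q$; this defines $G_s$ for all $s\ge 1$). For $j\ge 1$ let $\mathbf A_{(j)}$ be the $k\times k$ matrix whose $(r,l)$ entry is $q^{(l-1)j}$ if $r+l\le k+1$ and $0$ otherwise. Let $\mathbf h^{(0)}$ be the identity matrix and $\mathbf h^{(j)}=\mathbf h^{(j-1)}\mathbf A_{(j)}$ for $j\ge1$, and let ${}_ih^{(j)}_l\in\mathbb C[q]$ denote the $(i,l)$ entry of $\mathbf h^{(j)}$. For $1\le i\le k$ let $\mathcal P_i$ be the set of partitions $p_1\ge\cdots\ge p_n>0$ such that $p_s-p_{s+k-1}\ge 2$ whenever $s\ge 1$ and $s+k-1\le n$, and such that $1$ appears at most $k-i$ times. Theorem 4.2. Let $1\le i\le k$ and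 $j\ge 1$. Then $G_i$ is the generating function of $\mathcal P_i$, that is, the coefficient of $q^m$ in $G_i$ is the number of partitions of $m$ in $\mathcal P_i$, and the expansion $$G_i=\sum_{l=1}^{k}{}_ih^{(j)}_l\,G_{(k-1)j+l}$$ holds and decomposes $G_i$ according to the number of times the part $j$ appears: for each $l=1,\dots,k$, the term ${}_ih^{(j)}_l\,G_{(k-1)j+l}$ is the generating function of the partitions in $\mathcal P_i$ in which $j$ appears exactly $l-1$ times. Moreover, in every partition in $\mathcal P_i$ the part $j$ appears at most $k-1$ times, so that the numbers of appearances $0,1,\dots,k-1$ account for all of $\mathcal P_i$. -/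

import Mathlib

namespace Gordon

open scoped PowerSeries.WithPiTopology in
/-- The infinite product `∏ 1 / (1 - q ^ n)` over all `n ≥ 1` with
`n ≢ 0, ± (k + 1 - i) (mod 2 k + 1)`, as a formal power series in `q`.
The running index `m` stands for `n = m + 1`. -/
noncomputable def gordonProduct (k i : ℕ) : PowerSeries ℂ :=
  ∏' m : ℕ,
    if ¬ ((m : ℤ) + 1 ≡ 0 [ZMOD 2 * k + 1]) ∧
        ¬ ((m : ℤ) + 1 ≡ (k : ℤ) + 1 - i [ZMOD 2 * k + 1]) ∧
        ¬ ((m : ℤ) + 1 ≡ -((k : ℤ) + 1 - i) [ZMOD 2 * k + 1])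
    then ((1 : PowerSeries ℂ) - PowerSeries.X ^ (m + 1))⁻¹ else 1

open scoped PowerSeries.WithPiTopology in
open Classical in
/-- The infinite product above converges, whatever set of indices is selected. -/
theorem multipliable_gordonProduct (P : ℕ → Prop) :
    Multipliable fun m : ℕ =>
      if P m then ((1 : PowerSeries ℂ) - PowerSeries.X ^ (m + 1))⁻¹ else 1 := by
  have h : ∀ m : ℕ, (if P m then ((1 : PowerSeries ℂ) - PowerSeries.X ^ (m + 1))⁻¹ else 1) =
      1 + (if P m then PowerSeries.X ^ (m + 1) *
        ((1 : PowerSeries ℂ) - PowerSeries.X ^ (m + 1))⁻¹ else 0) := by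
    intro m
    split_ifs with hP
    · have hc : PowerSeries.constantCoeff ((1 : PowerSeries ℂ) - PowerSeries.X ^ (m + 1)) ≠ 0 := by
        simp
      have := PowerSeries.mul_inv_cancel _ hc
      linear_combination this
    · simp
  simp_rw [h]
  apply PowerSeries.WithPiTopology.multipliable_one_add_of_tendsto_order_atTop_nhds_top
  refine ENat.tendsto_nhds_top_iff_natCast_lt.mpr fun n => Filter.eventually_atTop.mpr ⟨n, ?_⟩
  intro m hm
  split_ifs with hP
  · refine lt_of_lt_of_le ?_ (PowerSeries.le_order_mul _ _)
    rw [PowerSeries.order_X_pow]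
    refine lt_of_lt_of_le ?_ le_self_add
    exact_mod_cast Nat.lt_succ_of_le hm
  · simp

/-- The variable `q` as a formal Laurent series. -/
noncomputable def q : LaurentSeries ℂ := HahnSeries.single 1 1

/-- The sequence of formal series `G_s`, `s ≥ 1` (for a given `k ≥ 2`), living a priori among the
formal Laurent series because of the divisions by powers of `q`.  For `1 ≤ s ≤ k`, `G_s` is the
infinite product; every `s > k` is uniquely `(k - 1) j + i` with `j ≥ 1` and `2 ≤ i ≤ k`, and then
`G_s = (G_{(k-1)(j-1)+k-i+1} - G_{(k-1)(j-1)+k-i+2}) / q ^ ((i-1) j)`; see `G_of_le` and `G_rec`.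
(The value at `s = 0`, and all values when `k < 2`, are irrelevant.) -/
noncomputable def G (k s : ℕ) : LaurentSeries ℂ :=
  if _hs : s ≤ k ∨ k < 2 then HahnSeries.ofPowerSeries ℤ ℂ (gordonProduct k s)
  else
    let j := (s - 2) / (k - 1)
    let i := (s - 2) % (k - 1) + 2
    (G k ((k - 1) * (j - 1) + (k - i) + 1) - G k ((k - 1) * (j - 1) + (k - i) + 2)) /
      q ^ ((i - 1) * j)
termination_by s
decreasing_by
  all_goals
    obtain ⟨_h1, _h2⟩ := not_or.mp _hs
    have hlt := Nat.mod_lt (s - 2) (show k - 1 > 0 by omega)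
    have hdm := Nat.div_add_mod (s - 2) (k - 1)
    have hj : 1 ≤ (s - 2) / (k - 1) := (Nat.one_le_div_iff (by omega)).mpr (by omega)
    obtain ⟨j', hj'⟩ := Nat.exists_eq_add_of_le' hj
    simp only [hj', Nat.add_sub_cancel] at *
    rw [Nat.mul_add] at hdm
    omega

theorem G_of_le {k i : ℕ} (hi : i ≤ k) :
    G k i = HahnSeries.ofPowerSeries ℤ ℂ (gordonProduct k i) := by
  rw [G, dif_pos (Or.inl hi)]

theorem G_rec {k j i : ℕ} (hk : 2 ≤ k) (hj : 1 ≤ j) (hi : 2 ≤ i) (hik : i ≤ k) :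
    G k ((k - 1) * j + i) =
      (G k ((k - 1) * (j - 1) + (k - i) + 1) - G k ((k - 1) * (j - 1) + (k - i) + 2)) /
        q ^ ((i - 1) * j) := by
  have h1 : ((k - 1) * j + i - 2) = (i - 2) + (k - 1) * j := by omega
  have h2 : k - 1 ≤ (k - 1) * j := Nat.le_mul_of_pos_right _ hj
  have hd : ((k - 1) * j + i - 2) / (k - 1) = j := by
    rw [h1, Nat.add_mul_div_left _ _ (by omega), Nat.div_eq_of_lt (by omega), zero_add]
  have hm : ((k - 1) * j + i - 2) % (k - 1) = i - 2 := by
    rw [h1, Nat.add_mul_mod_self_left, Nat.mod_eq_of_lt (by omega)]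
  rw [G, dif_neg (by omega)]
  simp only [hd, hm, Nat.sub_add_cancel hi]

/-- The `k × k` matrix `A_(j)`.  Rows and columns are numbered from `0` here: the entry in row `r`
and column `l` is `q ^ (l j)` on and above the antidiagonal and `0` below it. -/
noncomputable def A (k j : ℕ) : Matrix (Fin k) (Fin k) (Polynomial ℂ) :=
  Matrix.of fun r l => if (r : ℕ) + l < k then Polynomial.X ^ ((l : ℕ) * j) else 0

/-- The `k × k` matrix `h^(j)` of polynomials: `h^(0)` is the identity matrix and
`h^(j) = h^(j-1) A_(j)` for `j ≥ 1`.  With rows and columns numbered from `0`, its `(i, l)` entry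
is the coefficient `_{i+1}h^(j)_{l+1}`. -/
noncomputable def h (k : ℕ) : ℕ → Matrix (Fin k) (Fin k) (Polynomial ℂ)
  | 0 => 1
  | j + 1 => h k j * A k (j + 1)

/-- A polynomial in `q` regarded as a formal Laurent series in `q`. -/
noncomputable def polyToLaurent (p : Polynomial ℂ) : LaurentSeries ℂ :=
  HahnSeries.ofPowerSeries ℤ ℂ (p : PowerSeries ℂ)

/-- The parts of a partition in weakly decreasing order `p_1 ≥ p_2 ≥ ⋯ ≥ p_n`. -/
def sortedParts {m : ℕ} (p : m.Partition) : List ℕ := p.parts.sort (· ≥ ·)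

/-- Parts at distance `t` have difference at least `2`: `p_s - p_{s+t} ≥ 2` whenever both parts
exist. -/
def DiffAtLeastTwoAtDistance (t : ℕ) {m : ℕ} (p : m.Partition) : Prop :=
  ∀ s : ℕ, ∀ hs : s + t < (sortedParts p).length,
    (sortedParts p)[s + t] + 2 ≤ (sortedParts p)[s]

/-- Partitions of type `(a, b)`: difference at least `2` at distance `a`, and `1` appears at most
`b` times. -/
def IsOfType (a b : ℕ) {m : ℕ} (p : m.Partition) : Prop :=
  DiffAtLeastTwoAtDistance a p ∧ p.parts.count 1 ≤ b

/-- The generating function of a class `P` of partitions: the coefficient of `q ^ m` is the number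
of partitions of `m` in the class. -/
noncomputable def partitionGF (P : ∀ m : ℕ, m.Partition → Prop) : PowerSeries ℂ :=
  PowerSeries.mk fun m => ((Set.ncard {p : m.Partition | P m p} : ℕ) : ℂ)

end Gordon

namespace Gordon

/-! ### Partitions with bounded consecutive multiplicities, built up from the smallest part. -/

section Partitions

/-! The difference condition at distance `k - 1` says that `v` and `v + 1` together appear at most
`k - 1` times, for every `v`. This makes the class recursive in the smallest part: removing `r`
copies of `n` leaves a partition into parts at least `n + 1` in which `n + 1` appears at most `k - 1
- r` times. Hence the tail series `tailGF` satisfy `tailGF_eq_sum`.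

Gordon's theorem (`gordonProduct_eq_tailGF`) is proved by comparing two evaluations of the same
alternating sums. For each `j` the sums of `gordonTerm`, namely `(q; q)_∞ J_{k,i}(0; q ^ j; q)`,
obey the recursion of the tail series, termwise up to a telescoping boundary (`gordonTerm_rec`).
Modulo `X ^ L` both sides are known once `j ≥ L`, so descending in `j` gives agreement at `j = 0` up
to the factor `(q; q)_∞`. There the sum is also a theta series, which the Jacobi triple product
turns into the product over the excluded residues; cancelling `(q; q)_∞` leaves the product for
`G_i`.

The recursion defining `G_s` is then the difference of two tail recursions with adjacent caps, so
every `G_s` is a tail series (`G_eq_tailGF`). The matrix `A_(n)` encodes the removal of the part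
`n`, and `h^(j)` the removal of `1, …, j`; column `l` (from `0`) of the last factor singles out the
partitions with exactly `l` copies of `j`. -/

theorem length_filter_pair (l : List ℕ) (v : ℕ) :
    (l.filter fun x => x = v ∨ x = v + 1).length = l.count v + l.count (v + 1) := by
  induction l with
  | nil => simp
  | cons a l ih =>
    simp only [List.filter_cons, List.count_cons]
    grind

/-- In a weakly decreasing list, parts at distance `t` differ by at least `2` if and only if
any two consecutive integers together appear at most `t` times. -/
theorem diff_at_distance_iff_count {l : List ℕ} (hl : l.Pairwise (· ≥ ·)) (t : ℕ) :
    (∀ s : ℕ, ∀ hs : s + t < l.length, l[s + t] + 2 ≤ l[s]) ↔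
      ∀ v, l.count v + l.count (v + 1) ≤ t := by
  have hmono : ∀ a b : ℕ, ∀ (hab : a ≤ b) (hb : b < l.length), l[b] ≤ l[a] := by
    intro a b hab hb
    rcases hab.eq_or_lt with rfl | hlt
    · exact le_rfl
    · exact List.pairwise_iff_getElem.mp hl a b _ hb hlt
  constructor
  · intro H v
    by_contra! hv
    rw [← length_filter_pair] at hv
    -- More than `t` entries equal to `v` or `v + 1` sit at increasing positions, so two of them are
    -- at least `t` places apart, yet they differ by at most `1`.
    obtain ⟨f, hf⟩ := List.sublist_iff_exists_fin_orderEmbedding_get_eq.mp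
      (List.filter_sublist (l := l) (p := fun x => decide (x = v ∨ x = v + 1)))
    have hmem : ∀ x, l.get (f x) = v ∨ l.get (f x) = v + 1 := by
      intro x
      rw [← hf x]
      simpa using (List.mem_filter.mp (List.get_mem _ x)).2
    have hstep : ∀ x : ℕ, ∀ hx : x < (l.filter fun x => x = v ∨ x = v + 1).length,
        (f ⟨0, by omega⟩ : ℕ) + x ≤ f ⟨x, hx⟩ := by
      intro x
      induction x with
      | zero => intro hx; simp
      | succ x ih =>
        intro hx
        have h1 := ih (by omega)
        have h2 : f ⟨x, by omega⟩ < f ⟨x + 1, hx⟩ := f.strictMono (by simp)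
        have h3 : (f ⟨x, by omega⟩ : ℕ) < f ⟨x + 1, hx⟩ := h2
        omega
    have h0 := hstep t hv
    have hlt := (f ⟨t, hv⟩).isLt
    have h1 := H (f ⟨0, by omega⟩) (by omega)
    have h2 := hmono _ _ h0 hlt
    have h3 := hmem ⟨0, by omega⟩
    have h4 := hmem ⟨t, hv⟩
    simp only [List.get_eq_getElem] at h3 h4
    omega
  · intro H s hs
    by_contra! hlt
    -- By monotonicity the whole window of `t + 1` entries from `s` takes only two consecutive
    -- values, which then appear too often.
    have hsub : ((l.drop s).take (t + 1)).Sublist l :=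
      (List.take_sublist _ _).trans (List.drop_sublist _ _)
    have hall : ∀ x ∈ (l.drop s).take (t + 1), x = l[s + t] ∨ x = l[s + t] + 1 := by
      intro x hx
      obtain ⟨n, hn, rfl⟩ := List.getElem_of_mem hx
      simp only [List.length_take, List.length_drop] at hn
      simp only [List.getElem_take, List.getElem_drop]
      have h1 := hmono s (s + n) (by omega) (by omega)
      have h2 := hmono (s + n) (s + t) (by omega) (by omega)
      omega
    have hlen := length_filter_pair ((l.drop s).take (t + 1)) l[s + t]
    rw [List.filter_eq_self.mpr (by simpa using hall)] at hlen
    have h1 := hsub.count_le l[s + t]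
    have h2 := hsub.count_le (l[s + t] + 1)
    have h3 := H l[s + t]
    simp only [List.length_take, List.length_drop] at hlen
    omega

theorem diffAtLeastTwoAtDistance_iff (t : ℕ) {m : ℕ} (p : m.Partition) :
    DiffAtLeastTwoAtDistance t p ↔ ∀ v, p.parts.count v + p.parts.count (v + 1) ≤ t := by
  have hcount : ∀ v, (sortedParts p).count v = p.parts.count v := by
    intro v
    rw [← Multiset.coe_count, sortedParts, Multiset.sort_eq]
  unfold DiffAtLeastTwoAtDistance
  rw [diff_at_distance_iff_count (l := sortedParts p) (Multiset.pairwise_sort _ _)]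
  simp only [hcount]

/-- Generating function of the partitions whose multiset of parts satisfies `P`. -/
noncomputable def multisetGF (P : Multiset ℕ → Prop) : PowerSeries ℂ :=
  partitionGF fun _ p => P p.parts

open Classical in
theorem coeff_multisetGF (P : Multiset ℕ → Prop) (m : ℕ) :
    PowerSeries.coeff m (multisetGF P) = ∑ p : m.Partition, if P p.parts then 1 else 0 := by
  rw [multisetGF, partitionGF, PowerSeries.coeff_mk, Finset.sum_boole, Set.ncard_eq_toFinset_card']
  congr 2
  ext p
  simp

theorem multisetGF_congr {P P' : Multiset ℕ → Prop} (h : ∀ s, (∀ x ∈ s, 0 < x) → (P s ↔ P' s)) :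
    multisetGF P = multisetGF P' := by
  classical
  ext m
  simp only [coeff_multisetGF]
  exact Finset.sum_congr rfl fun p _ => by rw [h p.parts fun x hx => p.parts_pos hx]

/-- Splitting a class of partitions according to the number of appearances of `n`. -/
theorem multisetGF_eq_sum_count {P : Multiset ℕ → Prop} (n c : ℕ)
    (h : ∀ s, P s → s.count n < c) :
    multisetGF P = ∑ r ∈ Finset.range c, multisetGF fun s => P s ∧ s.count n = r := by
  classical
  ext m
  simp only [map_sum, coeff_multisetGF]
  rw [Finset.sum_comm]
  refine Finset.sum_congr rfl fun p _ => ?_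
  by_cases hp : P p.parts
  · simp [hp, h _ hp]
  · simp [hp]

/-- Removing the `r` copies of the smallest part `n`. -/
theorem multisetGF_peel {n r : ℕ} (hn : 1 ≤ n) {P P' : Multiset ℕ → Prop}
    (h : ∀ s : Multiset ℕ, (∀ x ∈ s, n + 1 ≤ x) → (P (s + Multiset.replicate r n) ↔ P' s)) :
    multisetGF (fun s => ((∀ x ∈ s, n ≤ x) ∧ P s) ∧ s.count n = r) =
      PowerSeries.X ^ (r * n) * multisetGF fun s => (∀ x ∈ s, n + 1 ≤ x) ∧ P' s := by
  have hsplit : ∀ s : Multiset ℕ, s.count n = r →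
      s.filter (· ≠ n) + Multiset.replicate r n = s := by
    intro s hs
    have := Multiset.filter_add_not (fun x => x = n) s
    rw [Multiset.filter_eq', hs, add_comm] at this
    exact this
  have hcard : ∀ s : Multiset ℕ, s.count n = r → s.sum = (s.filter (· ≠ n)).sum + r * n := by
    intro s hs
    conv_lhs => rw [← hsplit s hs]
    simp
  have hge : ∀ s : Multiset ℕ, (∀ x ∈ s, n ≤ x) → ∀ x ∈ s.filter (· ≠ n), n + 1 ≤ x := by
    intro s hs x hx
    obtain ⟨h1, h2⟩ := Multiset.mem_filter.mp hx
    have := hs x h1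
    omega
  ext m
  rw [PowerSeries.coeff_X_pow_mul']
  split_ifs with hm
  · simp only [multisetGF, partitionGF, PowerSeries.coeff_mk]
    congr 1
    refine Set.ncard_congr (fun p hp => ⟨p.parts.filter (· ≠ n), fun hx =>
      p.parts_pos (Multiset.mem_of_mem_filter hx), ?_⟩) ?_ ?_ ?_
    · have := hcard _ hp.2
      rw [p.parts_sum] at this
      omega
    · rintro p ⟨⟨h1, h2⟩, h3⟩
      refine ⟨hge _ h1, (h _ (hge _ h1)).mp ?_⟩
      rwa [hsplit _ h3]
    · rintro p p' hp hp' heq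
      have heq' := congrArg Nat.Partition.parts heq
      simp only at heq'
      ext1
      rw [← hsplit _ hp.2, ← hsplit _ hp'.2, heq']
    · rintro p ⟨h1, h2⟩
      have hnot : n ∉ p.parts := fun hx => by have := h1 n hx; omega
      refine ⟨⟨p.parts + Multiset.replicate r n, ?_, ?_⟩, ⟨⟨?_, ?_⟩, ?_⟩, ?_⟩
      · intro x hx
        rcases Multiset.mem_add.mp hx with hx | hx
        · exact p.parts_pos hx
        · rw [Multiset.eq_of_mem_replicate hx]; omega
      · simp [p.parts_sum, hm]
      · intro x hx
        rcases Multiset.mem_add.mp hx with hx | hx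
        · exact (Nat.le_succ n).trans (h1 x hx)
        · rw [Multiset.eq_of_mem_replicate hx]
      · exact (h _ h1).mpr h2
      · simp [Multiset.count_eq_zero_of_notMem hnot]
      · ext1
        simp only [Multiset.filter_add]
        have h3 : p.parts.filter (· ≠ n) = p.parts :=
          Multiset.filter_eq_self.mpr fun x hx heq => hnot (by rwa [heq] at hx)
        have h4 : (Multiset.replicate r n).filter (· ≠ n) = 0 :=
          Multiset.filter_eq_nil.mpr fun x hx hne => hne (Multiset.eq_of_mem_replicate hx)
        rw [h3, h4, add_zero]
  · simp only [multisetGF, partitionGF, PowerSeries.coeff_mk]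
    have : {p : m.Partition | ((∀ x ∈ p.parts, n ≤ x) ∧ P p.parts) ∧ p.parts.count n = r} = ∅ := by
      refine Set.eq_empty_of_forall_notMem fun p hp => hm ?_
      have := hcard _ hp.2
      rw [p.parts_sum] at this
      omega
    rw [this]
    simp

/-- Any two consecutive integers together appear at most `t` times. -/
def ConsecutiveCountLE (t : ℕ) (s : Multiset ℕ) : Prop :=
  ∀ v, s.count v + s.count (v + 1) ≤ t

/-- Only the pairs containing `n` are affected: `(n - 1, n)` is harmless because `r ≤ t`, and `(n, n
+ 1)` becomes a cap on the multiplicity of `n + 1`. -/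
theorem consecutiveCountLE_add_replicate {t n r : ℕ} (hn : 1 ≤ n) (hr : r ≤ t) {s : Multiset ℕ}
    (hs : ∀ x ∈ s, n + 1 ≤ x) :
    ConsecutiveCountLE t (s + Multiset.replicate r n) ↔
      ConsecutiveCountLE t s ∧ s.count (n + 1) ≤ t - r := by
  have h0 : ∀ v, v ≤ n → s.count v = 0 := fun v hv =>
    Multiset.count_eq_zero_of_notMem fun hx => by have := hs v hx; omega
  simp only [ConsecutiveCountLE, Multiset.count_add, Multiset.count_replicate]
  constructor
  · intro H
    refine ⟨fun v => ?_, ?_⟩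
    · have := H v
      omega
    · have := H n
      rw [h0 n le_rfl] at this
      simp at this
      omega
  · rintro ⟨H1, H2⟩ v
    have h1 := H1 v
    have h2 := h0 v
    have h3 := h0 (v + 1)
    split_ifs <;> first | omega | (subst_vars; omega)

/-- Partitions with parts at least `n`, with `n` appearing at most `c` times, in which any two
consecutive integers together appear at most `t` times, and satisfying `R`. -/
noncomputable def tailGF (t n c : ℕ) (R : Multiset ℕ → Prop) : PowerSeries ℂ :=
  multisetGF fun s => (∀ x ∈ s, n ≤ x) ∧ ConsecutiveCountLE t s ∧ s.count n ≤ c ∧ R s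

theorem tailGF_count_eq {t n c r : ℕ} (hn : 1 ≤ n) (hc : c ≤ t) (hr : r ≤ c)
    {R R' : Multiset ℕ → Prop}
    (hR : ∀ s : Multiset ℕ, (∀ x ∈ s, n + 1 ≤ x) → (R (s + Multiset.replicate r n) ↔ R' s)) :
    tailGF t n c (fun s => R s ∧ s.count n = r) =
      PowerSeries.X ^ (r * n) * tailGF t (n + 1) (t - r) R' := by
  unfold tailGF
  rw [← multisetGF_peel hn (P := fun s => ConsecutiveCountLE t s ∧ s.count n ≤ c ∧ R s)]
  · exact multisetGF_congr fun s _ => by tauto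
  · intro s hs
    have h0 : s.count n = 0 :=
      Multiset.count_eq_zero_of_notMem fun hx => by have := hs n hx; omega
    rw [hR s hs, consecutiveCountLE_add_replicate hn (hr.trans hc) hs]
    simp [h0, hr]
    tauto

/-- The basic recursion. The side condition `R` must not notice the removed part; it later records
the multiplicity of a larger part. -/
theorem tailGF_eq_sum {t n c : ℕ} (hn : 1 ≤ n) (hc : c ≤ t) {R : Multiset ℕ → Prop}
    (hR : ∀ r, ∀ s : Multiset ℕ, (∀ x ∈ s, n + 1 ≤ x) →
      (R (s + Multiset.replicate r n) ↔ R s)) :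
    tailGF t n c R =
      ∑ r ∈ Finset.range (c + 1), PowerSeries.X ^ (r * n) * tailGF t (n + 1) (t - r) R := by
  rw [tailGF, multisetGF_eq_sum_count n (c + 1) fun s hs => Nat.lt_succ_of_le hs.2.2.1]
  refine Finset.sum_congr rfl fun r hr => ?_
  rw [← tailGF_count_eq hn hc (Nat.lt_succ_iff.mp (Finset.mem_range.mp hr)) (hR r), tailGF]
  exact multisetGF_congr fun s _ => by tauto

theorem tailGF_count_eq_zero {t n c r : ℕ} (hr : c < r) (R : Multiset ℕ → Prop) :
    tailGF t n c (fun s => R s ∧ s.count n = r) = 0 := by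
  classical
  ext m
  rw [tailGF, coeff_multisetGF]
  refine (Finset.sum_eq_zero fun p _ => if_neg ?_).trans (by simp)
  rintro ⟨-, -, h1, -, h2⟩
  omega

/-- Below degree `n`, only the empty partition has all parts at least `n`. -/
theorem X_pow_dvd_tailGF_sub_one (t n c : ℕ) :
    (PowerSeries.X : PowerSeries ℂ) ^ n ∣ tailGF t n c (fun _ => True) - 1 := by
  classical
  rw [PowerSeries.X_pow_dvd_iff]
  intro m hm
  rw [map_sub, tailGF, coeff_multisetGF, PowerSeries.coeff_one, sub_eq_zero]
  by_cases h0 : m = 0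
  · subst h0
    simp [ConsecutiveCountLE]
  · rw [if_neg h0]
    refine Finset.sum_eq_zero fun p _ => if_neg ?_
    rintro ⟨h1, -⟩
    obtain ⟨x, hx⟩ := Multiset.exists_mem_of_ne_zero (s := p.parts) (by
      intro h; apply h0; rw [← p.parts_sum, h]; rfl)
    have h2 := h1 x hx
    have h3 := p.le_of_mem_parts hx
    omega

end Partitions


/-! ### Alternating sums satisfying the same recursion, modulo powers of `X`. -/

section AlternatingSums

open PowerSeries

/-- Reduction of power series modulo `X ^ L`. -/
noncomputable def modX (L : ℕ) :
    PowerSeries ℂ →+* PowerSeries ℂ ⧸ Ideal.span {(X : PowerSeries ℂ) ^ L} :=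
  Ideal.Quotient.mk _

theorem modX_eq_iff {L : ℕ} {f g : PowerSeries ℂ} : modX L f = modX L g ↔ X ^ L ∣ f - g := by
  rw [modX, Ideal.Quotient.eq, Ideal.mem_span_singleton]

theorem modX_eq_zero {L : ℕ} {f : PowerSeries ℂ} (h : X ^ L ∣ f) : modX L f = 0 := by
  rw [← map_zero (modX L), modX_eq_iff, sub_zero]
  exact h

theorem modX_X_pow {L m : ℕ} (h : L ≤ m) : modX L (X ^ m) = 0 :=
  modX_eq_zero (pow_dvd_pow X h)

theorem eq_of_modX_eq {f g : PowerSeries ℂ} (h : ∀ L, modX L f = modX L g) : f = g := by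
  ext m
  have := PowerSeries.X_pow_dvd_iff.mp (modX_eq_iff.mp (h (m + 1))) m m.lt_succ_self
  rwa [map_sub, sub_eq_zero] at this

/-- A product of factors congruent to `1` modulo `X ^ L` from some index on. -/
theorem modX_prod_range {L M N : ℕ} (hMN : M ≤ N) {f : ℕ → PowerSeries ℂ}
    (hf : ∀ m, M ≤ m → modX L (f m) = 1) :
    modX L (∏ m ∈ Finset.range N, f m) = modX L (∏ m ∈ Finset.range M, f m) := by
  obtain ⟨d, rfl⟩ := Nat.exists_eq_add_of_le hMN
  rw [Finset.prod_range_add, map_mul, map_prod (modX L) (fun x => f (M + x)),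
    Finset.prod_eq_one fun x _ => hf _ (Nat.le_add_right _ _), mul_one]

/-- The terms of the alternating sums for the functions `J_{k,i}(0; q ^ j; q)`,
multiplied by `(q; q)_∞`. -/
noncomputable def gordonTerm (k i j n : ℕ) : PowerSeries ℂ :=
  (-1) ^ n * X ^ (k * j * n + (2 * k + 1) * n.choose 2 + (2 * k + 1 - i) * n) *
    (1 - X ^ (i * (2 * n + j + 1))) * ∏ t ∈ Finset.range j, (1 - X ^ (n + t + 1))

/-- The boundary terms in the recursion for the alternating sums. -/
noncomputable def gordonBoundary (k i j n : ℕ) : PowerSeries ℂ :=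
  (-1) ^ n * X ^ (k * j * n + (2 * k + 1) * n.choose 2 + (2 * k - i) * n) *
    (1 - X ^ n) * ∏ t ∈ Finset.range j, (1 - X ^ (n + t + 1))

/-- Termwise form of `J_{k,i+1}(x) - J_{k,i}(x) = (x q) ^ i J_{k,k-i}(x q)` at `x = q ^ j`; the
discrepancy is a difference of boundary terms, so it telescopes over `n`. -/
theorem gordonTerm_rec {k i : ℕ} (hi : i < k) (j n : ℕ) :
    gordonTerm k (i + 1) j n - gordonTerm k i j n =
      X ^ (i * (j + 1)) * gordonTerm k (k - i) (j + 1) n +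
        (gordonBoundary k i j n - gordonBoundary k i j (n + 1)) := by
  obtain ⟨d, rfl⟩ := Nat.exists_eq_add_of_le hi.le
  have hprod : (1 - X ^ (n + 1)) * ∏ t ∈ Finset.range j, (1 - (X : PowerSeries ℂ) ^ (n + 1 + t + 1)) =
      (∏ t ∈ Finset.range j, (1 - X ^ (n + t + 1))) * (1 - X ^ (n + j + 1)) := by
    rw [← Finset.prod_range_succ (fun t => 1 - (X : PowerSeries ℂ) ^ (n + t + 1)),
      Finset.prod_range_succ', mul_comm]
    congr 1
    exact Finset.prod_congr rfl fun t _ => by rw [show n + 1 + t + 1 = n + (t + 1) + 1 by ring]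
  have hc : (n + 1).choose 2 = n + n.choose 2 := by
    rw [Nat.choose_succ_succ' n 1, Nat.choose_one_right]
  unfold gordonTerm gordonBoundary
  rw [mul_assoc _ (1 - X ^ (n + 1)), hprod, hc, Finset.prod_range_succ,
    show 2 * (i + d) + 1 - (i + 1) = i + 2 * d by omega,
    show 2 * (i + d) + 1 - i = i + 2 * d + 1 by omega,
    show 2 * (i + d) - i = i + 2 * d by omega,
    show 2 * (i + d) + 1 - (i + d - i) = 2 * i + d + 1 by omega,
    show i + d - i = d by omega]
  generalize ∏ t ∈ Finset.range j, (1 - (X : PowerSeries ℂ) ^ (n + t + 1)) = P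
  generalize n.choose 2 = c
  ring

theorem gordonTerm_zero (k j n : ℕ) : gordonTerm k 0 j n = 0 := by simp [gordonTerm]

theorem modX_sum_gordonTerm_rec {k i : ℕ} (hi : i < k) (j L : ℕ) :
    modX L (∑ n ∈ Finset.range L, gordonTerm k (i + 1) j n) =
      modX L (∑ n ∈ Finset.range L, gordonTerm k i j n) +
        modX L (X ^ (i * (j + 1)) * ∑ n ∈ Finset.range L, gordonTerm k (k - i) (j + 1) n) := by
  have h1 := Finset.sum_congr rfl fun n (_ : n ∈ Finset.range L) => gordonTerm_rec hi j n
  rw [Finset.sum_add_distrib, Finset.sum_sub_distrib, Finset.sum_range_sub', ← Finset.mul_sum] at h1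
  -- The lower boundary dies through its factor `1 - X ^ 0`, the upper one because `2 * k - i ≥ 1`
  -- puts `X ^ L` in it.
  have h0 : gordonBoundary k i j 0 = 0 := by simp [gordonBoundary]
  have hL : modX L (gordonBoundary k i j L) = 0 := by
    refine modX_eq_zero ?_
    unfold gordonBoundary
    refine Dvd.dvd.mul_right (Dvd.dvd.mul_right (Dvd.dvd.mul_left (pow_dvd_pow _ ?_) _) _) _
    have : 1 * L ≤ (2 * k - i) * L := Nat.mul_le_mul_right _ (by omega)
    omega
  have h2 := congrArg (modX L) h1
  rw [h0, map_sub, map_add, map_sub (modX L) 0, hL, map_zero, sub_zero, add_zero] at h2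
  exact sub_eq_iff_eq_add'.mp h2

/-- Iterating down to the zero series at `i = 0` gives exactly the shape of `tailGF_eq_sum`. -/
theorem modX_sum_gordonTerm (k j L : ℕ) {i : ℕ} (hi : i ≤ k) :
    modX L (∑ n ∈ Finset.range L, gordonTerm k i j n) =
      ∑ r ∈ Finset.range i,
        modX L (X ^ (r * (j + 1)) * ∑ n ∈ Finset.range L, gordonTerm k (k - r) (j + 1) n) := by
  induction i with
  | zero => simp [gordonTerm_zero]
  | succ i ih =>
    rw [modX_sum_gordonTerm_rec (by omega), ih (by omega), Finset.sum_range_succ]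

/-- Terms with `n ≥ 1` carry `X ^ (k * j * n)` and vanish, so only `n = 0` survives: this is the
starting point of the descent in `j`. -/
theorem modX_sum_gordonTerm_of_le {k i j L : ℕ} (hi : 1 ≤ i) (hik : i ≤ k) (hj : L ≤ j) :
    modX L (∑ n ∈ Finset.range L, gordonTerm k i j n) =
      modX L (∏ t ∈ Finset.range L, (1 - X ^ (t + 1))) := by
  rcases Nat.eq_zero_or_pos L with rfl | hL
  · rw [modX_eq_iff]
    simp
  · rw [map_sum, Finset.sum_eq_single_of_mem 0 (Finset.mem_range.mpr hL)]
    · have h1 : modX L (X ^ (i * (j + 1))) = 0 :=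
        modX_X_pow (by nlinarith)
      rw [← modX_prod_range hj]
      · simp only [gordonTerm, map_mul, map_sub, mul_zero, zero_add, h1]
        simp
      · intro m hm
        rw [map_sub, modX_X_pow (by omega), sub_zero, map_one]
    · intro n _ hn
      refine modX_eq_zero ?_
      unfold gordonTerm
      refine Dvd.dvd.mul_right (Dvd.dvd.mul_right (Dvd.dvd.mul_left (pow_dvd_pow _ ?_) _) _) _
      have h2 : 1 * j * 1 ≤ k * j * n :=
        Nat.mul_le_mul (Nat.mul_le_mul_right _ (by omega)) (by omega)
      omega

/-- The alternating sums and the generating functions satisfy the same recursion, hence agree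
up to the factor `(q; q)_∞`. -/
theorem modX_sum_gordonTerm_eq_tailGF {k i j : ℕ} (L : ℕ) (hi : 1 ≤ i) (hik : i ≤ k) :
    modX L (∑ n ∈ Finset.range L, gordonTerm k i j n) =
      modX L ((∏ t ∈ Finset.range L, (1 - X ^ (t + 1))) *
        tailGF (k - 1) (j + 1) (i - 1) fun _ => True) := by
  rcases le_total L j with hj | hj
  · rw [modX_sum_gordonTerm_of_le hi hik hj, map_mul]
    have : modX L (tailGF (k - 1) (j + 1) (i - 1) fun _ => True) = modX L 1 :=
      modX_eq_iff.mpr ((pow_dvd_pow X (by omega)).trans (X_pow_dvd_tailGF_sub_one _ _ _))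
    rw [this, map_one, mul_one]
  -- The index `i` must vary, since passing from `j` to `j + 1` replaces it by `k - r`.
  · induction hj using Nat.decreasingInduction generalizing i with
    | self =>
      rw [modX_sum_gordonTerm_of_le hi hik le_rfl, map_mul]
      have : modX L (tailGF (k - 1) (L + 1) (i - 1) fun _ => True) = modX L 1 :=
        modX_eq_iff.mpr ((pow_dvd_pow X (by omega)).trans (X_pow_dvd_tailGF_sub_one _ _ _))
      rw [this, map_one, mul_one]
    | of_succ j _ ih =>
      rw [modX_sum_gordonTerm _ _ _ hik, tailGF_eq_sum (by omega) (by omega) (by simp),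
        Nat.sub_add_cancel hi, Finset.mul_sum, map_sum]
      refine Finset.sum_congr rfl fun r hr => ?_
      have hr' := Finset.mem_range.mp hr
      rw [map_mul, ih (by omega) (by omega), ← map_mul, show k - r - 1 = k - 1 - r by omega]
      congr 1
      ring

end AlternatingSums


/-! ### The Jacobi triple product, from a finite identity to a congruence. -/

section TripleProduct

open PowerSeries

/-- The finite product `(Q; Q)_n` with `Q = X ^ c`. -/
noncomputable def qPoch (c n : ℕ) : PowerSeries ℂ :=
  ∏ m ∈ Finset.range n, (1 - X ^ (c * (m + 1)))

theorem qPoch_succ (c n : ℕ) : qPoch c (n + 1) = qPoch c n * (1 - X ^ (c * (n + 1))) :=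
  Finset.prod_range_succ _ _

theorem constantCoeff_qPoch {c : ℕ} (hc : 0 < c) (n : ℕ) :
    PowerSeries.constantCoeff (qPoch c n) = 1 := by
  rw [qPoch, map_prod]
  refine Finset.prod_eq_one fun m _ => ?_
  simp [hc.ne']

/-- The reciprocal of `(Q; Q)_n`, extended by `0` to negative `n`. -/
noncomputable def qPochInv (c : ℕ) (n : ℤ) : PowerSeries ℂ :=
  if 0 ≤ n then (qPoch c n.toNat)⁻¹ else 0

theorem qPochInv_of_neg (c : ℕ) {n : ℤ} (hn : n < 0) : qPochInv c n = 0 :=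
  if_neg (by omega)

theorem qPoch_mul_qPochInv {c : ℕ} (hc : 0 < c) (n : ℕ) : qPoch c n * qPochInv c n = 1 := by
  rw [qPochInv, if_pos (by omega), Int.toNat_natCast]
  exact PowerSeries.mul_inv_cancel _ (by rw [constantCoeff_qPoch hc]; exact one_ne_zero)

/-- The extension by `0` is what makes this hold for every integer: at `n = 0` the factor `1 - X ^
0` vanishes. -/
theorem qPochInv_sub_one {c : ℕ} (hc : 0 < c) (n : ℤ) :
    qPochInv c (n - 1) = qPochInv c n * (1 - X ^ (c * n.toNat)) := by
  rcases lt_trichotomy n 0 with hn | rfl | hn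
  · rw [qPochInv_of_neg c hn, qPochInv_of_neg c (by omega), zero_mul]
  · rw [qPochInv_of_neg c (by omega)]
    simp
  · obtain ⟨m, rfl⟩ : ∃ m : ℕ, n = (m : ℤ) + 1 := ⟨(n - 1).toNat, by omega⟩
    have h1 := qPoch_mul_qPochInv hc m
    have h2 := qPoch_mul_qPochInv hc (m + 1)
    rw [qPoch_succ] at h2
    rw [add_sub_cancel_right, show ((m : ℤ) + 1).toNat = m + 1 by omega]
    push_cast at h2
    calc qPochInv c m = qPochInv c m * (qPoch c m * (1 - X ^ (c * (m + 1))) * qPochInv c (m + 1)) := by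
          rw [h2, mul_one]
      _ = (qPoch c m * qPochInv c m) * (qPochInv c (m + 1) * (1 - X ^ (c * (m + 1)))) := by ring
      _ = _ := by rw [h1, one_mul]

/-- The exponent `a n (n + 1) / 2 + b n (n - 1) / 2` in the theta series. -/
def thetaExp (a b : ℕ) (n : ℤ) : ℕ :=
  ((a * (n * (n + 1)) + b * (n * (n - 1))) / 2).toNat

theorem two_mul_thetaExp (a b : ℕ) (n : ℤ) :
    2 * (thetaExp a b n : ℤ) = a * (n * (n + 1)) + b * (n * (n - 1)) := by
  have h1 : Even (n * (n + 1)) := Int.even_mul_succ_self n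
  have h2 : Even (n * (n - 1)) := Int.even_mul_pred_self n
  have h3 : 0 ≤ n * (n + 1) := by rcases le_or_gt 0 n with h | h <;> nlinarith
  have h4 : 0 ≤ n * (n - 1) := by rcases le_or_gt n 0 with h | h <;> nlinarith
  have h5 : Even ((a : ℤ) * (n * (n + 1)) + b * (n * (n - 1))) :=
    (h1.mul_left _).add (h2.mul_left _)
  have h6 : 0 ≤ (a : ℤ) * (n * (n + 1)) + b * (n * (n - 1)) := by positivity
  rw [thetaExp, Int.toNat_of_nonneg (by omega)]
  exact Int.two_mul_ediv_two_of_even h5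

theorem thetaExp_neg (a b : ℕ) (n : ℤ) : thetaExp a b (-n) = thetaExp b a n := by
  have h1 := two_mul_thetaExp a b (-n)
  have h2 := two_mul_thetaExp b a n
  have : (2 * thetaExp a b (-n) : ℤ) = 2 * thetaExp b a n := by rw [h1, h2]; ring
  omega

theorem natAbs_le_thetaExp {a b : ℕ} (ha : 1 ≤ a) (hb : 1 ≤ b) (n : ℤ) :
    n.natAbs ≤ thetaExp a b n := by
  have h1 := two_mul_thetaExp a b n
  have h3 : 0 ≤ n * (n + 1) := by rcases le_or_gt 0 n with h | h <;> nlinarith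
  have h4 : 0 ≤ n * (n - 1) := by rcases le_or_gt n 0 with h | h <;> nlinarith
  have ha' : (1 : ℤ) ≤ a := by exact_mod_cast ha
  have hb' : (1 : ℤ) ≤ b := by exact_mod_cast hb
  have h5 := mul_le_mul_of_nonneg_right ha' h3
  have h6 := mul_le_mul_of_nonneg_right hb' h4
  have h7 : n ≤ n * n := by nlinarith
  have h8 : -n ≤ n * n := by nlinarith
  have : (n.natAbs : ℤ) ≤ thetaExp a b n := by
    rcases le_total 0 n with h | h
    · rw [Int.natAbs_of_nonneg h]; nlinarith
    · rw [Int.ofNat_natAbs_of_nonpos h]; nlinarith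
  exact_mod_cast this

/-- The terms of the theta series. -/
noncomputable def thetaTerm (a b : ℕ) (n : ℤ) : PowerSeries ℂ :=
  (((n.negOnePow : ℤˣ) : ℤ) : PowerSeries ℂ) * X ^ thetaExp a b n

theorem thetaTerm_neg (a b : ℕ) (n : ℤ) : thetaTerm a b (-n) = thetaTerm b a n := by
  rw [thetaTerm, thetaTerm, thetaExp_neg, Int.negOnePow_neg]

theorem thetaTerm_mul_X_pow (a b r : ℕ) {n : ℤ} (hn : n ≤ r + 1) :
    thetaTerm a b n * X ^ ((a + b) * (r + 1 - n).toNat) =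
      -(X ^ (a + (a + b) * r) * thetaTerm a b (n - 1)) := by
  have hs : ((((n - 1).negOnePow : ℤˣ) : ℤ) : PowerSeries ℂ) =
      -(((n.negOnePow : ℤˣ) : ℤ) : PowerSeries ℂ) := by
    rw [Int.negOnePow_sub]
    simp
  have he : thetaExp a b n + (a + b) * (r + 1 - n).toNat =
      a + (a + b) * r + thetaExp a b (n - 1) := by
    have h1 := two_mul_thetaExp a b n
    have h2 := two_mul_thetaExp a b (n - 1)
    have h3 : ((r + 1 - n).toNat : ℤ) = r + 1 - n := Int.toNat_of_nonneg (by omega)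
    zify
    rw [h3]
    linarith
  rw [thetaTerm, thetaTerm, hs, mul_assoc, ← pow_add, he, pow_add]
  ring

/-- The terms of the finite form of the triple product identity. -/
noncomputable def tripleTerm (a b r s : ℕ) (n : ℤ) : PowerSeries ℂ :=
  thetaTerm a b n * (qPochInv (a + b) (r - n) * qPochInv (a + b) (s + n))

theorem tripleTerm_eq_zero (a b r s : ℕ) {n : ℤ} (hn : n < -s ∨ r < n) :
    tripleTerm a b r s n = 0 := by
  rcases hn with hn | hn
  · rw [tripleTerm, qPochInv_of_neg _ (n := s + n) (by omega), mul_zero, mul_zero]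
  · rw [tripleTerm, qPochInv_of_neg _ (n := r - n) (by omega), zero_mul, mul_zero]

theorem support_tripleTerm_subset (a b r s : ℕ) :
    Function.support (tripleTerm a b r s) ⊆ Set.Icc (-s : ℤ) r := by
  intro n hn
  by_contra h
  exact hn (tripleTerm_eq_zero _ _ _ _ (by rw [Set.mem_Icc] at h; omega))

theorem finite_support_tripleTerm (a b r s : ℕ) : (Function.support (tripleTerm a b r s)).Finite :=
  (Set.finite_Icc _ _).subset (support_tripleTerm_subset a b r s)

/-- A `q`-Pascal rule. With `A` and `B` the powers of `X ^ (a + b)` of exponents `r + 1 - n` and `s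
+ n`, split `1 - A B = (1 - A) + A (1 - B)`; the theta term absorbs the extra `A` by shifting `n` to
`n - 1`. -/
theorem tripleTerm_succ {a b : ℕ} (hab : 0 < a + b) (r s : ℕ) (n : ℤ) :
    (1 - X ^ ((a + b) * (r + s + 1))) * tripleTerm a b (r + 1) s n =
      tripleTerm a b r s n + -X ^ (a + (a + b) * r) * tripleTerm a b r s (n - 1) := by
  by_cases h1 : n ≤ r + 1
  · by_cases h2 : -(s : ℤ) ≤ n
    · have e1 := qPochInv_sub_one hab (r + 1 - n)
      have e2 := qPochInv_sub_one hab (s + n)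
      have e3 := thetaTerm_mul_X_pow a b r h1
      have e4 : (X : PowerSeries ℂ) ^ ((a + b) * (r + s + 1)) =
          X ^ ((a + b) * (r + 1 - n).toNat) * X ^ ((a + b) * (s + n).toNat) := by
        rw [← pow_add, ← mul_add]
        congr 2
        omega
      unfold tripleTerm
      rw [show (r : ℤ) - (n - 1) = r + 1 - n by ring, show (s : ℤ) + (n - 1) = s + n - 1 by ring,
        show ((r + 1 : ℕ) : ℤ) = r + 1 by push_cast; rfl, show (r : ℤ) - n = r + 1 - n - 1 by ring,
        e1, e2, e4]
      linear_combination qPochInv (a + b) (r + 1 - n) * qPochInv (a + b) (s + n) *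
        (1 - X ^ ((a + b) * (s + n).toNat)) * e3
    · rw [tripleTerm_eq_zero _ _ _ _ (by omega), tripleTerm_eq_zero _ _ _ _ (by omega),
        tripleTerm_eq_zero _ _ _ _ (by omega)]
      ring
  · rw [tripleTerm_eq_zero _ _ _ _ (by push_cast; omega), tripleTerm_eq_zero _ _ _ _ (by omega),
      tripleTerm_eq_zero _ _ _ _ (by omega)]
    ring

/-- Summation over all integers is invariant under the shift, so the two terms of the Pascal rule
merge into one factor. -/
theorem finsum_tripleTerm_succ {a b : ℕ} (hab : 0 < a + b) (r s : ℕ) :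
    (1 - X ^ ((a + b) * (r + s + 1))) * ∑ᶠ n, tripleTerm a b (r + 1) s n =
      (1 - X ^ (a + (a + b) * r)) * ∑ᶠ n, tripleTerm a b r s n := by
  have hshift : ∑ᶠ n : ℤ, tripleTerm a b r s (n - 1) = ∑ᶠ n, tripleTerm a b r s n :=
    finsum_comp_equiv (Equiv.subRight (1 : ℤ))
  have hfin : (Function.support fun n : ℤ => tripleTerm a b r s (n - 1)).Finite :=
    (finite_support_tripleTerm a b r s).preimage (Equiv.subRight (1 : ℤ)).injective.injOn
  rw [mul_finsum,
    finsum_congr (tripleTerm_succ hab r s), finsum_add_distrib (finite_support_tripleTerm _ _ _ _)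
      (hfin.subset (Function.support_mul_subset_right _ _)), ← mul_finsum, hshift]
  ring

/-- The substitution `n ↦ -n`; it lets the induction on `r` serve for `s` as well. -/
theorem finsum_tripleTerm_comm (a b r s : ℕ) :
    ∑ᶠ n, tripleTerm a b r s n = ∑ᶠ n, tripleTerm b a s r n := by
  rw [← finsum_comp_equiv (Equiv.neg ℤ)]
  refine finsum_congr fun n => ?_
  rw [Equiv.neg_apply, tripleTerm, tripleTerm, thetaTerm_neg, add_comm a b, sub_neg_eq_add,
    ← sub_eq_add_neg, mul_comm (qPochInv _ _)]

theorem finsum_tripleTerm_zero (a b : ℕ) : ∑ᶠ n, tripleTerm a b 0 0 n = 1 := by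
  rw [finsum_eq_single _ 0 fun n hn => tripleTerm_eq_zero _ _ _ _ (by push_cast; omega)]
  simp [tripleTerm, thetaTerm, thetaExp, qPochInv, qPoch]

theorem qPoch_mul_finsum_tripleTerm_left {a b : ℕ} (hab : 0 < a + b) (r s : ℕ) :
    qPoch (a + b) (r + s) * ∑ᶠ n, tripleTerm a b r s n =
      (∏ m ∈ Finset.range r, (1 - X ^ (a + (a + b) * m))) *
        (qPoch (a + b) s * ∑ᶠ n, tripleTerm a b 0 s n) := by
  induction r with
  | zero => simp
  | succ r ih =>
    rw [show r + 1 + s = r + s + 1 by ring, qPoch_succ, mul_assoc, finsum_tripleTerm_succ hab,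
      mul_left_comm, ih, Finset.prod_range_succ]
    ring

/-- A finite form of the Jacobi triple product identity. -/
theorem qPoch_mul_finsum_tripleTerm {a b : ℕ} (hab : 0 < a + b) (r s : ℕ) :
    qPoch (a + b) (r + s) * ∑ᶠ n, tripleTerm a b r s n =
      (∏ m ∈ Finset.range r, (1 - X ^ (a + (a + b) * m))) *
        ∏ m ∈ Finset.range s, (1 - X ^ (b + (a + b) * m)) := by
  have h := qPoch_mul_finsum_tripleTerm_left (a := b) (b := a) (by omega) s 0
  have h0 : qPoch (b + a) 0 = 1 := Finset.prod_range_zero _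
  rw [finsum_tripleTerm_zero, h0, mul_one, mul_one, add_zero, finsum_tripleTerm_comm,
    add_comm b a] at h
  rw [qPoch_mul_finsum_tripleTerm_left hab, h]

theorem sum_Ico_int {M : Type*} [AddCommMonoid M] (f : ℤ → M) (N : ℕ) :
    ∑ n ∈ Finset.Ico (-N : ℤ) N, f n = ∑ n ∈ Finset.range N, (f n + f (-(n + 1))) := by
  induction N with
  | zero => simp
  | succ N ih =>
    rw [Finset.sum_range_succ, ← ih]
    have h1 : Finset.Ico (-((N + 1 : ℕ) : ℤ)) ((N + 1 : ℕ) : ℤ) =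
        insert (N : ℤ) (insert (-((N : ℤ) + 1)) (Finset.Ico (-N : ℤ) N)) := by
      ext x
      simp only [Finset.mem_Ico, Finset.mem_insert]
      omega
    rw [h1, Finset.sum_insert (by simp only [Finset.mem_Ico, Finset.mem_insert]; omega),
      Finset.sum_insert (by simp only [Finset.mem_Ico]; omega)]
    abel

theorem modX_qPoch {c L N : ℕ} (hc : 0 < c) (hN : L ≤ N) :
    modX L (qPoch c N) = modX L (qPoch c L) := by
  refine modX_prod_range hN fun m hm => ?_
  rw [map_sub, map_one, modX_X_pow (by nlinarith), sub_zero]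

/-- For `|n| < L`, the bound `2 * L ≤ N` keeps `N - n` and `N + n` above `L`, so both reciprocals
cancel modulo `X ^ L`. For larger `|n|` the theta term itself vanishes. -/
theorem modX_qPoch_mul_tripleTerm {a b L N : ℕ} (ha : 1 ≤ a) (hb : 1 ≤ b) (hN : 2 * L ≤ N) (n : ℤ) :
    modX L (qPoch (a + b) N * qPoch (a + b) (N + N) * tripleTerm a b N N n) =
      modX L (thetaTerm a b n) := by
  by_cases hn : n.natAbs < L
  · obtain ⟨x, hx⟩ : ∃ x : ℕ, (N : ℤ) - n = x := ⟨(N - n).toNat, by omega⟩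
    obtain ⟨y, hy⟩ : ∃ y : ℕ, (N : ℤ) + n = y := ⟨(N + n).toNat, by omega⟩
    have h1 := congrArg (modX L) (qPoch_mul_qPochInv (c := a + b) (by omega) x)
    have h2 := congrArg (modX L) (qPoch_mul_qPochInv (c := a + b) (by omega) y)
    rw [map_mul, modX_qPoch (by omega) (by omega), map_one] at h1 h2
    rw [tripleTerm, hx, hy]
    simp only [map_mul]
    rw [modX_qPoch (N := N) (by omega) (by omega), modX_qPoch (N := N + N) (by omega) (by omega)]
    linear_combination (modX L (thetaTerm a b n)) * (modX L (qPoch (a + b) L)) *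
      (modX L (qPochInv (a + b) y)) * h1 + modX L (thetaTerm a b n) * h2
  · have h0 : modX L (thetaTerm a b n) = 0 :=
      modX_eq_zero (Dvd.dvd.mul_left (pow_dvd_pow _
        ((not_lt.mp hn).trans (natAbs_le_thetaExp ha hb n))) _)
    rw [tripleTerm]
    simp only [map_mul]
    rw [h0]
    ring

/-- The Jacobi triple product identity modulo `X ^ L`. -/
theorem modX_triple_product {a b L N : ℕ} (ha : 1 ≤ a) (hb : 1 ≤ b) (hN : 2 * L ≤ N) :
    modX L (qPoch (a + b) N * ((∏ m ∈ Finset.range N, (1 - X ^ (a + (a + b) * m))) *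
        ∏ m ∈ Finset.range N, (1 - X ^ (b + (a + b) * m)))) =
      modX L (∑ n ∈ Finset.range L, (thetaTerm a b n + thetaTerm a b (-(n + 1)))) := by
  -- The half-open interval allows `n` to be paired with `-(n + 1)`.
  have hsub : Function.support (tripleTerm a b N N) ⊆
      Finset.Ico (-((N + 1 : ℕ) : ℤ)) ((N + 1 : ℕ) : ℤ) := by
    refine (support_tripleTerm_subset a b N N).trans fun n hn => ?_
    simp only [Set.mem_Icc, Finset.coe_Ico, Set.mem_Ico] at hn ⊢
    omega
  rw [← qPoch_mul_finsum_tripleTerm (by omega), finsum_eq_sum_of_support_subset _ hsub,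
    sum_Ico_int, ← mul_assoc, Finset.mul_sum, map_sum, map_sum]
  have h1 : ∀ n ∈ Finset.range (N + 1), modX L (qPoch (a + b) N * qPoch (a + b) (N + N) *
      (tripleTerm a b N N n + tripleTerm a b N N (-(n + 1)))) =
      modX L (thetaTerm a b n + thetaTerm a b (-(n + 1))) := by
    intro n _
    rw [mul_add, map_add, modX_qPoch_mul_tripleTerm ha hb hN, modX_qPoch_mul_tripleTerm ha hb hN,
      map_add]
  rw [Finset.sum_congr rfl h1]
  symm
  refine Finset.sum_subset (Finset.range_subset_range.mpr (by omega)) fun n _ hn => ?_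
  rw [Finset.mem_range, not_lt] at hn
  rw [map_add, modX_eq_zero, modX_eq_zero, add_zero]
  · exact Dvd.dvd.mul_left (pow_dvd_pow _ (le_trans (by omega) (natAbs_le_thetaExp ha hb _))) _
  · exact Dvd.dvd.mul_left (pow_dvd_pow _ (le_trans (by omega) (natAbs_le_thetaExp ha hb _))) _

/-- The exponents at `n` and `-(n + 1)` differ by `i * (2 * n + 1)` and the signs are opposite,
which produces the factor `1 - X ^ (i * (2 * n + 1))`. -/
theorem thetaTerm_add_eq_gordonTerm {k i : ℕ} (hi : i ≤ 2 * k + 1) (n : ℕ) :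
    thetaTerm (2 * k + 1 - i) i n + thetaTerm (2 * k + 1 - i) i (-(n + 1)) =
      gordonTerm k i 0 n := by
  obtain ⟨d, hd⟩ := Nat.exists_eq_add_of_le hi
  have hd' : 2 * k + 1 - i = d := by omega
  have hc : 2 * (n.choose 2 : ℤ) = n * (n - 1) := by
    have he := Nat.two_mul_div_two_of_even (Nat.even_mul_pred_self n)
    rw [← Nat.choose_two_right] at he
    rcases n with _ | n
    · simp
    · rw [Nat.add_sub_cancel] at he
      push_cast
      rw [add_sub_cancel_right]
      exact_mod_cast he
  have h1 : thetaExp d i n = (i + d) * n.choose 2 + d * n := by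
    have := two_mul_thetaExp d i n
    zify
    nlinarith [congrArg (fun z : ℤ => ((i : ℤ) + d) * z) hc]
  have h2 : thetaExp d i (-(n + 1)) = (i + d) * n.choose 2 + d * n + i * (2 * n + 1) := by
    have := two_mul_thetaExp d i (-(n + 1))
    zify
    nlinarith [congrArg (fun z : ℤ => ((i : ℤ) + d) * z) hc]
  rw [hd', thetaTerm, thetaTerm, h1, h2, gordonTerm, hd, Nat.add_sub_cancel_left,
    Int.negOnePow_neg, Int.negOnePow_succ, pow_add _ _ (i * (2 * n + 1))]
  simp
  ring

end TripleProduct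


/-! ### Gordon's theorem: the infinite product as a generating function. -/

section ProductSide

open PowerSeries

open scoped PowerSeries.WithPiTopology in
theorem modX_tprod {L : ℕ} {f : ℕ → PowerSeries ℂ} (hf : Multipliable f)
    (h : ∀ m, L ≤ m → modX L (f m) = 1) :
    modX L (∏' m, f m) = modX L (∏ m ∈ Finset.range L, f m) := by
  rw [modX_eq_iff, PowerSeries.X_pow_dvd_iff]
  intro d hd
  rw [map_sub, sub_eq_zero]
  have h1 := ((PowerSeries.WithPiTopology.continuous_coeff ℂ d).tendsto _).comp
    hf.hasProd.tendsto_prod_nat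
  refine tendsto_nhds_unique h1 (tendsto_const_nhds.congr' ?_)
  filter_upwards [Filter.eventually_ge_atTop L] with N hN
  have h2 := PowerSeries.X_pow_dvd_iff.mp (modX_eq_iff.mp (modX_prod_range hN h)) d hd
  rw [map_sub, sub_eq_zero] at h2
  exact h2.symm

theorem one_sub_X_pow_mul_inv (m : ℕ) :
    ((1 : PowerSeries ℂ) - X ^ (m + 1))⁻¹ * (1 - X ^ (m + 1)) = 1 :=
  PowerSeries.inv_mul_cancel _ (by simp)

theorem prod_range_mul_blocks {M : Type*} [CommMonoid M] (c N : ℕ) (f : ℕ → M) :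
    ∏ m ∈ Finset.range (c * N), f m =
      ∏ j ∈ Finset.range N, ∏ r ∈ Finset.range c, f (c * j + r) := by
  induction N with
  | zero => simp
  | succ N ih => rw [Finset.prod_range_succ, ← ih, Nat.mul_succ, Finset.prod_range_add]

/-- The set of indices `m` such that `m + 1` is admissible in the product for `G_i`. -/
def Admissible (k i m : ℕ) : Prop :=
  ¬ ((m : ℤ) + 1 ≡ 0 [ZMOD 2 * k + 1]) ∧
    ¬ ((m : ℤ) + 1 ≡ (k : ℤ) + 1 - i [ZMOD 2 * k + 1]) ∧
    ¬ ((m : ℤ) + 1 ≡ -((k : ℤ) + 1 - i) [ZMOD 2 * k + 1])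

/-- As the index stands for `m + 1`, the excluded residues `0`, `b`, `-b` appear as `2 * k`, `b -
1`, `2 * k - b`. -/
theorem admissible_iff {k i b : ℕ} (hb : 1 ≤ b) (hbk : b ≤ k) (hib : i + b = k + 1) {j r : ℕ}
    (hr : r < 2 * k + 1) :
    Admissible k i ((2 * k + 1) * j + r) ↔ r ≠ 2 * k ∧ r ≠ b - 1 ∧ r ≠ 2 * k - b := by
  have key : ∀ x y : ℤ, |y| < 2 * k + 1 → (∃ z, x = y + (2 * k + 1) * z) →
      (((2 * k + 1 : ℤ) ∣ x) ↔ y = 0) := by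
    rintro x y hy ⟨z, rfl⟩
    rw [dvd_add_left (dvd_mul_right _ _)]
    exact ⟨fun h => Int.eq_zero_of_abs_lt_dvd h hy, fun h => h ▸ dvd_zero _⟩
  have hi : (k : ℤ) + 1 - i = b := by omega
  unfold Admissible
  rw [hi]
  simp only [Int.modEq_iff_dvd]
  rw [key _ (2 * k - r) (by rw [abs_lt]; omega) ⟨-(j + 1), by push_cast; ring⟩,
    key _ (b - 1 - r) (by rw [abs_lt]; omega) ⟨-j, by push_cast; ring⟩,
    key _ (2 * k - b - r) (by rw [abs_lt]; omega) ⟨-(j + 1), by push_cast; ring⟩]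
  omega

open Classical in
-- Each block of `2 * k + 1` indices contributes three excluded factors, at distinct places because
-- `1 ≤ b ≤ k`; these are the factors of the triple product.
theorem prod_not_admissible {k i b : ℕ} (hb : 1 ≤ b) (hbk : b ≤ k) (hib : i + b = k + 1) (N : ℕ) :
    ∏ m ∈ Finset.range ((2 * k + 1) * N),
        (if Admissible k i m then (1 : PowerSeries ℂ) else 1 - X ^ (m + 1)) =
      qPoch (2 * k + 1) N *
        ((∏ m ∈ Finset.range N, (1 - X ^ ((2 * k + 1 - b) + (2 * k + 1) * m))) *
          ∏ m ∈ Finset.range N, (1 - X ^ (b + (2 * k + 1) * m))) := by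
  rw [prod_range_mul_blocks, qPoch, ← Finset.prod_mul_distrib, ← Finset.prod_mul_distrib]
  refine Finset.prod_congr rfl fun j _ => ?_
  have hsub : ({2 * k, 2 * k - b, b - 1} : Finset ℕ) ⊆ Finset.range (2 * k + 1) := by
    intro x hx
    simp only [Finset.mem_insert, Finset.mem_singleton] at hx
    rw [Finset.mem_range]
    omega
  have hna : ∀ r ∈ ({2 * k, 2 * k - b, b - 1} : Finset ℕ),
      (if Admissible k i ((2 * k + 1) * j + r) then (1 : PowerSeries ℂ)
        else 1 - X ^ ((2 * k + 1) * j + r + 1)) = 1 - X ^ ((2 * k + 1) * j + r + 1) := by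
    intro r hr
    have hr' := Finset.mem_range.mp (hsub hr)
    simp only [Finset.mem_insert, Finset.mem_singleton] at hr
    rw [if_neg]
    rw [admissible_iff hb hbk hib hr']
    omega
  rw [← Finset.prod_subset hsub, Finset.prod_congr rfl hna, Finset.prod_insert, Finset.prod_insert,
    Finset.prod_singleton]
  · rw [show (2 * k + 1) * j + 2 * k + 1 = (2 * k + 1) * (j + 1) by ring,
      show (2 * k + 1) * j + (2 * k - b) + 1 = 2 * k + 1 - b + (2 * k + 1) * j by omega,
      show (2 * k + 1) * j + (b - 1) + 1 = b + (2 * k + 1) * j by omega]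
  · rw [Finset.mem_singleton]
    omega
  · simp only [Finset.mem_insert, Finset.mem_singleton]
    omega
  · intro r hr hr2
    simp only [Finset.mem_insert, Finset.mem_singleton] at hr2
    rw [if_pos]
    rw [admissible_iff hb hbk hib (Finset.mem_range.mp hr)]
    omega

open scoped PowerSeries.WithPiTopology in
/-- The infinite product is the generating function of the partitions of the corresponding
type: the analytic form of Gordon's partition theorem. -/
theorem gordonProduct_eq_tailGF {k i b : ℕ} (hb : 1 ≤ b) (hbk : b ≤ k) (hib : i + b = k + 1) :
    gordonProduct k i = tailGF (k - 1) 1 (b - 1) fun _ => True := by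
  classical
  refine eq_of_modX_eq fun L => ?_
  set f : ℕ → PowerSeries ℂ := fun m =>
    if Admissible k i m then ((1 : PowerSeries ℂ) - X ^ (m + 1))⁻¹ else 1 with hfdef
  have hX : ∀ m, L ≤ m → modX L (1 - X ^ (m + 1)) = 1 := fun m hm => by
    rw [map_sub, modX_X_pow (by omega), sub_zero, map_one]
  have hf : ∀ m, L ≤ m → modX L (f m) = 1 := by
    intro m hm
    simp only [hfdef]
    split_ifs with h
    · have h1 := congrArg (modX L) (one_sub_X_pow_mul_inv m)
      rwa [map_mul, hX m hm, mul_one, map_one] at h1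
    · exact map_one _
  have hG : modX L (gordonProduct k i) = modX L (∏ m ∈ Finset.range L, f m) := by
    rw [← modX_tprod (multipliable_gordonProduct _) hf]
    congr 1
    rw [gordonProduct]
    refine tprod_congr fun m => ?_
    simp only [Admissible]
    congr
  have hLN : L ≤ (2 * k + 1) * (2 * L) := by nlinarith [Nat.zero_le (k * L)]
  have hfin : (∏ m ∈ Finset.range ((2 * k + 1) * (2 * L)), f m) *
      ∏ m ∈ Finset.range ((2 * k + 1) * (2 * L)), (1 - X ^ (m + 1)) =
      ∏ m ∈ Finset.range ((2 * k + 1) * (2 * L)),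
        (if Admissible k i m then (1 : PowerSeries ℂ) else 1 - X ^ (m + 1)) := by
    rw [← Finset.prod_mul_distrib]
    refine Finset.prod_congr rfl fun m _ => ?_
    simp only [hfdef]
    split_ifs
    · exact one_sub_X_pow_mul_inv m
    · exact one_mul _
  have hJ := modX_triple_product (a := 2 * k + 1 - b) (b := b) (L := L) (N := 2 * L)
    (by omega) hb le_rfl
  -- Both sides of the triple product become multiples of `(q; q)_L` modulo `X ^ L`, by
  -- `gordonProduct k i` and by the tail series; this factor is a unit.
  rw [Nat.sub_add_cancel (by omega), ← prod_not_admissible hb hbk hib, ← hfin,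
    Finset.sum_congr rfl fun n _ => thetaTerm_add_eq_gordonTerm (by omega : b ≤ 2 * k + 1) n,
    modX_sum_gordonTerm_eq_tailGF L hb hbk, map_mul, map_mul, modX_prod_range hLN hf,
    modX_prod_range hLN hX, ← hG, zero_add] at hJ
  have hu : modX L (∏ m ∈ Finset.range L, (1 - X ^ (m + 1))) * modX L (qPochInv 1 L) = 1 := by
    have h1 := congrArg (modX L) (qPoch_mul_qPochInv (c := 1) one_pos L)
    simpa only [qPoch, one_mul, map_mul, map_one] using h1
  linear_combination (modX L (qPochInv 1 L)) * hJ -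
    (modX L (gordonProduct k i) - modX L (tailGF (k - 1) 1 (b - 1) fun _ => True)) * hu

end ProductSide

/-! ### The series `G_s` and the matrix expansion. -/

section Expansion

open PowerSeries

theorem q_ne_zero : q ≠ 0 := HahnSeries.single_ne_zero one_ne_zero

theorem ofPowerSeries_X_pow (n : ℕ) :
    HahnSeries.ofPowerSeries ℤ ℂ ((X : PowerSeries ℂ) ^ n) = q ^ n := by
  rw [map_pow, HahnSeries.ofPowerSeries_X]
  rfl

/-- Only the partitions with exactly `c + 1` copies of `n` remain, hence the exact divisibility by
the power of `q` in the definition of `G_s`. -/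
theorem tailGF_succ_sub {t n c : ℕ} (hn : 1 ≤ n) (hc : c + 1 ≤ t) :
    tailGF t n (c + 1) (fun _ => True) - tailGF t n c (fun _ => True) =
      X ^ ((c + 1) * n) * tailGF t (n + 1) (t - (c + 1)) fun _ => True := by
  rw [tailGF_eq_sum hn hc (by simp), tailGF_eq_sum hn (by omega) (by simp),
    Finset.sum_range_succ _ (c + 1), add_sub_cancel_left]

/-- The series `G_s` as generating functions. -/
theorem G_eq_tailGF {k : ℕ} (hk : 2 ≤ k) (j : ℕ) {l : ℕ} (hl : l < k) :
    G k ((k - 1) * j + (l + 1)) =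
      HahnSeries.ofPowerSeries ℤ ℂ (tailGF (k - 1) (j + 1) (k - 1 - l) fun _ => True) := by
  induction j generalizing l with
  | zero =>
    rw [mul_zero, zero_add, G_of_le (by omega),
      gordonProduct_eq_tailGF (b := k - l) (by omega) (by omega) (by omega), zero_add,
      show k - l - 1 = k - 1 - l by omega]
  | succ j ih =>
    rcases Nat.eq_zero_or_pos l with rfl | hl0
    -- The levels overlap: the first index of level `j + 1` is the last of level `j`, where the cap
    -- is `0` and the recursion has a single term.
    · have h1 := ih (l := k - 1) (by omega)
      rw [show (k - 1) * j + (k - 1 + 1) = (k - 1) * (j + 1) + (0 + 1) by ring] at h1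
      rw [h1, tailGF_eq_sum (by omega) (by omega) (by simp)]
      simp
    -- These two series have caps `l` and `l - 1` on the part `j + 1`.
    · have h1 := ih (l := k - l - 1) (by omega)
      have h2 := ih (l := k - l) (by omega)
      rw [G_rec hk (by omega) (by omega) (by omega), Nat.add_sub_cancel, Nat.add_sub_cancel,
        show (k - 1) * j + (k - (l + 1)) + 1 = (k - 1) * j + (k - l - 1 + 1) by omega,
        show (k - 1) * j + (k - (l + 1)) + 2 = (k - 1) * j + (k - l + 1) by omega, h1, h2, ← map_sub,
        show k - 1 - (k - l - 1) = k - 1 - (k - l) + 1 by omega,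
        tailGF_succ_sub (by omega) (by omega), map_mul, ofPowerSeries_X_pow,
        show k - 1 - (k - l) + 1 = l by omega, mul_div_cancel_left₀ _ (pow_ne_zero _ q_ne_zero)]

theorem isOfType_iff {t c m : ℕ} (p : m.Partition) :
    IsOfType t c p ↔ ConsecutiveCountLE t p.parts ∧ p.parts.count 1 ≤ c := by
  rw [IsOfType, diffAtLeastTwoAtDistance_iff, ConsecutiveCountLE]

theorem partitionGF_isOfType (t c : ℕ) (R : Multiset ℕ → Prop) :
    (partitionGF fun _ p => IsOfType t c p ∧ R p.parts) = tailGF t 1 c R := by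
  have h : (partitionGF fun _ p => IsOfType t c p ∧ R p.parts) =
      multisetGF fun s => (ConsecutiveCountLE t s ∧ s.count 1 ≤ c) ∧ R s := by
    rw [multisetGF]
    simp only [isOfType_iff]
  rw [h, tailGF]
  refine multisetGF_congr fun s hs => ?_
  have : ∀ x ∈ s, 1 ≤ x := hs
  tauto

/-- One row of the matrix `A_(n)` performs the removal of the part `n`. -/
theorem tailGF_eq_sum_A {k n : ℕ} (hn : 1 ≤ n) (r : Fin k) {R : Multiset ℕ → Prop}
    (hR : ∀ r, ∀ s : Multiset ℕ, (∀ x ∈ s, n + 1 ≤ x) →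
      (R (s + Multiset.replicate r n) ↔ R s)) :
    tailGF (k - 1) n (k - 1 - r) R =
      ∑ l : Fin k, (A k n r l : PowerSeries ℂ) * tailGF (k - 1) (n + 1) (k - 1 - l) R := by
  simp only [A, Matrix.of_apply]
  rw [tailGF_eq_sum hn (by omega) hR,
    Fin.sum_univ_eq_sum_range (fun l => ((if (r : ℕ) + l < k then Polynomial.X ^ (l * n) else 0 :
      Polynomial ℂ) : PowerSeries ℂ) * tailGF (k - 1) (n + 1) (k - 1 - l) R) k]
  have hsub : Finset.range (k - 1 - r + 1) ⊆ Finset.range k :=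
    Finset.range_subset_range.mpr (by omega)
  rw [← Finset.sum_subset hsub]
  · refine Finset.sum_congr rfl fun l hl => ?_
    rw [Finset.mem_range] at hl
    rw [if_pos (by omega), Polynomial.coe_pow, Polynomial.coe_X]
  · intro l _ hl
    rw [Finset.mem_range] at hl
    rw [if_neg (by omega), Polynomial.coe_zero, zero_mul]

theorem coe_h_succ {k : ℕ} (n : ℕ) (i l : Fin k) :
    ((h k (n + 1) i l : Polynomial ℂ) : PowerSeries ℂ) =
      ∑ r : Fin k, (h k n i r : PowerSeries ℂ) * (A k (n + 1) r l : PowerSeries ℂ) := by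
  rw [h, Matrix.mul_apply, ← Polynomial.coeToPowerSeries.ringHom_apply, map_sum]
  simp

/-- The polynomials in `h^(n)` account for the parts `1, …, n`. -/
theorem tailGF_one_eq_sum_h {k : ℕ} (i : Fin k) (n : ℕ) {R : Multiset ℕ → Prop}
    (hR : ∀ m, 1 ≤ m → m ≤ n → ∀ r, ∀ s : Multiset ℕ, (∀ x ∈ s, m + 1 ≤ x) →
      (R (s + Multiset.replicate r m) ↔ R s)) :
    tailGF (k - 1) 1 (k - 1 - i) R =
      ∑ r : Fin k, (h k n i r : PowerSeries ℂ) * tailGF (k - 1) (n + 1) (k - 1 - r) R := by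
  induction n with
  | zero =>
    simp only [h, zero_add]
    rw [Finset.sum_eq_single i]
    · simp
    · intro r _ hr
      simp [Matrix.one_apply_ne hr.symm]
    · simp
  | succ n ih =>
    rw [ih fun m h1 h2 => hR m h1 (by omega)]
    simp only [tailGF_eq_sum_A (Nat.le_add_left 1 n) _ (hR (n + 1) (by omega) le_rfl),
      Finset.mul_sum]
    rw [Finset.sum_comm]
    refine Finset.sum_congr rfl fun l _ => ?_
    rw [coe_h_succ, Finset.sum_mul]
    exact Finset.sum_congr rfl fun r _ => by ring

/-- The contribution of the partitions in which `j` appears exactly `l` times. -/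
theorem tailGF_one_count {k : ℕ} (i l : Fin k) {j : ℕ} (hj : 1 ≤ j) :
    tailGF (k - 1) 1 (k - 1 - i) (fun s => s.count j = l) =
      (h k j i l : PowerSeries ℂ) * tailGF (k - 1) (j + 1) (k - 1 - l) fun _ => True := by
  obtain ⟨n, rfl⟩ := Nat.exists_eq_add_of_le' hj
  -- The parts below `j = n + 1` are removed first, as they do not affect the count of `j`;
  -- prescribing that count then keeps a single entry in each row of `A_(j)`.
  rw [tailGF_one_eq_sum_h i n]
  · have hrow : ∀ r : Fin k, tailGF (k - 1) (n + 1) (k - 1 - r) (fun s => s.count (n + 1) = l) =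
        (A k (n + 1) r l : PowerSeries ℂ) *
          tailGF (k - 1) (n + 1 + 1) (k - 1 - l) fun _ => True := by
      intro r
      have h1 : (fun s : Multiset ℕ => s.count (n + 1) = l) =
          fun s => (fun _ => True) s ∧ s.count (n + 1) = (l : ℕ) := by simp
      rw [h1, A, Matrix.of_apply]
      split_ifs with hr
      · rw [tailGF_count_eq (R' := fun _ => True) (by omega) (by omega) (by omega) (by simp),
          Polynomial.coe_pow, Polynomial.coe_X]
      · rw [tailGF_count_eq_zero (by omega), Polynomial.coe_zero, zero_mul]
    rw [coe_h_succ, Finset.sum_mul]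
    exact Finset.sum_congr rfl fun r _ => by rw [hrow, mul_assoc]
  · intro m _ hm r s _
    rw [Multiset.count_add, Multiset.count_replicate, if_neg (by omega), add_zero]

end Expansion

end Gordon

theorem theorem4p2 (k : ℕ) (hk : 2 ≤ k) (i : Fin k) (j : ℕ) (hj : 1 ≤ j) :
    -- `G_{i+1}` is the generating function of the partitions of type `(k - 1, k - (i + 1))`
    Gordon.G k (i + 1) = HahnSeries.ofPowerSeries ℤ ℂ
      (Gordon.partitionGF fun _ p => Gordon.IsOfType (k - 1) (k - (i + 1)) p) ∧
    -- the expansion of `G_{i+1}`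
    Gordon.G k (i + 1) =
      ∑ l : Fin k, Gordon.polyToLaurent (Gordon.h k j i l) * Gordon.G k ((k - 1) * j + (l + 1)) ∧
    -- its terms are the contributions of the partitions in which `j` appears `0, …, k - 1` times
    (∀ l : Fin k,
      Gordon.polyToLaurent (Gordon.h k j i l) * Gordon.G k ((k - 1) * j + (l + 1)) =
        HahnSeries.ofPowerSeries ℤ ℂ (Gordon.partitionGF fun _ p =>
          Gordon.IsOfType (k - 1) (k - (i + 1)) p ∧ p.parts.count j = l)) ∧
    -- and `j` appears at most `k - 1` times in each of the partitions counted by `G_{i+1}`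
    (∀ (m : ℕ) (p : m.Partition),
      Gordon.IsOfType (k - 1) (k - (i + 1)) p → p.parts.count j ≤ k - 1) := by
  have hc : k - ((i : ℕ) + 1) = k - 1 - i := by omega
  have hG : Gordon.G k (i + 1) = HahnSeries.ofPowerSeries ℤ ℂ
      (Gordon.tailGF (k - 1) 1 (k - 1 - i) fun _ => True) := by
    simpa using Gordon.G_eq_tailGF hk 0 i.isLt
  rw [hc]
  refine ⟨?_, ?_, fun l => ?_, fun m p hp => ?_⟩
  · rw [hG, ← Gordon.partitionGF_isOfType]
    simp only [and_true]
  · rw [hG, Gordon.tailGF_one_eq_sum_h i j (by simp), map_sum]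
    refine Finset.sum_congr rfl fun l _ => ?_
    rw [map_mul, Gordon.G_eq_tailGF hk j l.isLt, Gordon.polyToLaurent]
  · rw [Gordon.partitionGF_isOfType (k - 1) (k - 1 - i) fun s => s.count j = l,
      Gordon.tailGF_one_count i l hj, map_mul, Gordon.G_eq_tailGF hk j l.isLt,
      Gordon.polyToLaurent]
  · exact (Nat.le_add_right _ _).trans (((Gordon.isOfType_iff p).mp hp).1 j)
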